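/- Let $k$ be an algebraically closed field of arbitrary characteristic $p\ge 0$, let $V$ be a finite-dimensional vector space over $k$, and let $G$ be a finite abelian subgroup of $GL(V)$. Let $V/G=\operatorname{Spec} S(V^*)^G$, where $S(V^*)$ is the symmetric algebra of the dual space $V^*$ and $S(V^*)^G$ is its ring of $G$-invariants, and denote by $0\in V/G$ the image of the origin of $V$. Suppose that $0\in V/G$ is an isolated singularity, that is, the local ring $\mathcal{O}_{V/G,0}$ is not regular, and some Zariski open neighborhood of $0$ contains no singular (closed) point of $V/G$ other than $0$. Then $0\in V/G$ is formally isomorphic to a nonmodular cyclic quotient singularity: there is a finite cyclic subgroup $C$ of $GL(V)$, with $p\nmid |C|$ (no condition if $p=0$), such that $V/C=\operatorname{Spec} S(V^*)^C$ is singular at the image $0$ of the origin and the complete local rings $\widehat{\mathcal{O}}_{V/G,0}$ and $\widehat{\mathcal{O}}_{V/C,0}$ are isomorphic as $k$-algebras. -/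

import Mathlib

noncomputable section

namespace QuotientSingularity

open IsLocalRing

section Points

variable {A : Type*} [CommRing A]

/-- The point `x` of `Spec A` is singular: its local ring is not regular. -/
def IsSingularPoint (x : PrimeSpectrum A) : Prop :=
  ¬ IsRegularLocalRing (Localization.AtPrime x.asIdeal)

/-- `x` is an isolated singularity of `Spec A`: it is singular, and some Zariski open neighborhood
of `x` contains no singular (closed) point other than `x`. As usual for varieties, the points
are the closed points. -/
def IsIsolatedSingularity (x : PrimeSpectrum A) : Prop :=
  IsSingularPoint x ∧
    ∃ U : Set (PrimeSpectrum A), IsOpen U ∧ x ∈ U ∧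
      ∀ y ∈ U, IsClosed {y} → y ≠ x → ¬ IsSingularPoint y

/-- The complete local ring of `Spec A` at `x`. -/
abbrev CompleteLocalRing (x : PrimeSpectrum A) : Type _ :=
  AdicCompletion (maximalIdeal (Localization.AtPrime x.asIdeal)) (Localization.AtPrime x.asIdeal)

/-- Formal isomorphism, over `k`, of a point of `Spec A` with a point of `Spec B`: the complete
local rings are isomorphic as `k`-algebras. -/
def FormallyIsomorphic (k : Type*) [CommRing k] [Algebra k A] {B : Type*} [CommRing B]
    [Algebra k B] (x : PrimeSpectrum A) (y : PrimeSpectrum B) : Prop :=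
  Nonempty (CompleteLocalRing x ≃ₐ[k] CompleteLocalRing y)

end Points

section Quotient

variable {k V : Type*} [Field k] [AddCommGroup V] [Module k V]

variable (k V) in
/-- The symmetric algebra `S(V^*)`: the algebra of polynomial functions on `V`. -/
abbrev PolyRing : Type _ := SymmetricAlgebra k (Module.Dual k V)

/-- The substitution `f ↦ f ∘ g` on `S(V^*)` for `g ∈ GL(V)`. -/
def substitution (g : LinearMap.GeneralLinearGroup k V) : PolyRing k V →ₐ[k] PolyRing k V :=
  SymmetricAlgebra.lift
    (SymmetricAlgebra.ι k (Module.Dual k V) ∘ₗ (g : V →ₗ[k] V).dualMap)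

/-- The ring of invariants `S(V^*)^G`; the quotient `V/G` is its spectrum. -/
def invariantRing (G : Subgroup (LinearMap.GeneralLinearGroup k V)) :
    Subalgebra k (PolyRing k V) where
  carrier := {f | ∀ g ∈ G, substitution g f = f}
  mul_mem' ha hb g hg := by rw [map_mul, ha g hg, hb g hg]
  add_mem' ha hb g hg := by rw [map_add, ha g hg, hb g hg]
  algebraMap_mem' r g _ := (substitution g).commutes r

/-- Evaluation of polynomial functions at a vector `v`. -/
def evalAt (v : V) : PolyRing k V →ₐ[k] k :=
  SymmetricAlgebra.lift (Module.Dual.eval k V v)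

/-- The image `π(v)` of `v ∈ V` in `V/G = Spec S(V^*)^G`: the prime ideal of all invariants
vanishing at `v`. -/
def quotientPoint (G : Subgroup (LinearMap.GeneralLinearGroup k V)) (v : V) :
    PrimeSpectrum (invariantRing G) :=
  ⟨RingHom.ker ((evalAt v).comp (invariantRing G).val), RingHom.ker_isPrime _⟩

/-- `C` defines a nonmodular cyclic quotient singularity `0 ∈ V/C`: `C` is a finite cyclic linear
group whose order is not divisible by the characteristic of the field, and `V/C` is
singular at the image of the origin. -/
structure IsNonmodularCyclicQuotientSingularity
    (C : Subgroup (LinearMap.GeneralLinearGroup k V)) : Prop where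
  finite : Finite C
  cyclic : IsCyclic C
  nonmodular : ¬ ringChar k ∣ Nat.card C
  singular : IsSingularPoint (quotientPoint C 0)

end Quotient

end QuotientSingularity

end

noncomputable section

namespace QuotientSingularity

open IsLocalRing

/-! ### Transport of local rings and their completions along an algebra isomorphism. -/

section FormalIsomorphism

/-! The group has a common eigenvector `v`, since it is abelian and `k` is algebraically closed. The
image of the line through `v` meets every neighborhood of the singular point away from that point,
so `v` can be rescaled until its image is a regular point of `V/G`.

Let `χ` be the character of `G` on `v`, `N` its kernel, i.e. the stabilizer of `v`, and `n = dim V`.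
Then `G/N` is isomorphic to a finite subgroup of `kˣ`, hence cyclic of some order `m` prime to the
characteristic, and all modular phenomena are confined to `N`. Regularity is passed from `S^G` to
`S^N`: the translates of `v` under `G/N` are distinct multiples of `v`, separated by `S^N`, so `V/N
→ V/G` is unramified at `v` and `S^N` has at most `n` parameters there (`vanishing_le_sup_sq`).
Since `N` fixes `v`, translation by `v` carries this to the origin (`exists_parameters_translate`).

At the origin the grading is available. A generator `g` of `G/N` acts diagonalizably on `S^N`, so
the parameters can be chosen as homogeneous eigenvectors `y i`. By graded Nakayama
(`le_adjoin_of_vanishing_le`) and a dimension count, `S^N` is the polynomial ring in the `y i`.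
Hence `S^G`, the `g`-invariants in `S^N`, is isomorphic to the invariant ring of a diagonal cyclic
group on `V` (`exists_cyclic_of_diagonal`). The isomorphism already exists before completion and
respects the origin. -/

theorem factor_comp_quotientMap_evalₐ {k R R' : Type*} [CommRing k] [CommRing R] [CommRing R']
    [Algebra k R] [Algebra k R'] {I : Ideal R} {I' : Ideal R'} (f : R →ₐ[k] R')
    (h : ∀ n, I ^ n ≤ (I' ^ n).comap f) {m n : ℕ} (hle : m ≤ n) :
    (Ideal.Quotient.factorₐ k (Ideal.pow_le_pow_right hle)).comp
      ((Ideal.quotientMapₐ (I' ^ n) f (h n)).comp ((AdicCompletion.evalₐ I n).restrictScalars k)) =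
    (Ideal.quotientMapₐ (I' ^ m) f (h m)).comp ((AdicCompletion.evalₐ I m).restrictScalars k) := by
  ext x
  induction x using AdicCompletion.induction_on with
  | _ x =>
    have hx := AdicCompletion.Ideal.mk_eq_mk I hle x
    simp only [AlgHom.comp_apply, AlgHom.restrictScalars_apply, AdicCompletion.evalₐ_mk]
    rw [← hx]
    rfl

theorem pow_le_comap_pow {k R R' : Type*} [CommRing k] [CommRing R] [CommRing R']
    [Algebra k R] [Algebra k R'] {I : Ideal R} {I' : Ideal R'} (f : R →ₐ[k] R')
    (h : I ≤ I'.comap f) (n : ℕ) : I ^ n ≤ (I' ^ n).comap f :=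
  (Ideal.pow_right_mono h n).trans (Ideal.le_comap_pow f n)

/-- The map induced on adic completions by an algebra homomorphism. -/
def adicCompletionMap {k R R' : Type*} [CommRing k] [CommRing R] [CommRing R'] [Algebra k R]
    [Algebra k R'] {I : Ideal R} {I' : Ideal R'} (f : R →ₐ[k] R') (h : I ≤ I'.comap f) :
    AdicCompletion I R →ₐ[k] AdicCompletion I' R' :=
  AdicCompletion.liftAlgHom I'
    (fun n ↦ (Ideal.quotientMapₐ (I' ^ n) f (pow_le_comap_pow f h n)).comp
        ((AdicCompletion.evalₐ I n).restrictScalars k))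
    (factor_comp_quotientMap_evalₐ f (pow_le_comap_pow f h))

theorem evalₐ_adicCompletionMap_mk {k R R' : Type*} [CommRing k] [CommRing R] [CommRing R']
    [Algebra k R] [Algebra k R'] {I : Ideal R} {I' : Ideal R'} (f : R →ₐ[k] R')
    (h : I ≤ I'.comap f) (n : ℕ) (x : AdicCompletion I R) (r : R)
    (hr : AdicCompletion.evalₐ I n x = Ideal.Quotient.mk _ r) :
    AdicCompletion.evalₐ I' n (adicCompletionMap f h x) = Ideal.Quotient.mk _ (f r) := by
  refine (AdicCompletion.evalₐ_liftAlgHom I' _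
    (factor_comp_quotientMap_evalₐ f (pow_le_comap_pow f h)) n x).trans ?_
  simp only [AlgHom.comp_apply, AlgHom.restrictScalars_apply, hr]
  rfl

theorem adicCompletionMap_adicCompletionMap {k R R' : Type*} [CommRing k] [CommRing R]
    [CommRing R'] [Algebra k R] [Algebra k R'] {I : Ideal R} {I' : Ideal R'}
    (f : R →ₐ[k] R') (g : R' →ₐ[k] R) (h : I ≤ I'.comap f) (h' : I' ≤ I.comap g)
    (hgf : ∀ x, g (f x) = x) (x : AdicCompletion I R) :
    adicCompletionMap g h' (adicCompletionMap f h x) = x := by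
  refine AdicCompletion.ext_evalₐ fun n ↦ ?_
  obtain ⟨r, hr⟩ := Ideal.Quotient.mk_surjective (AdicCompletion.evalₐ I n x)
  rw [evalₐ_adicCompletionMap_mk g h' n _ (f r)
    (evalₐ_adicCompletionMap_mk f h n x r hr.symm), hgf, hr]

/-- Isomorphic pairs of a ring and an ideal have isomorphic completions. -/
def adicCompletionCongr {k R R' : Type*} [CommRing k] [CommRing R] [CommRing R'] [Algebra k R]
    [Algebra k R'] {I : Ideal R} {I' : Ideal R'} (e : R ≃ₐ[k] R')
    (h : I ≤ I'.comap (e : R →ₐ[k] R')) (h' : I' ≤ I.comap (e.symm : R' →ₐ[k] R)) :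
    AdicCompletion I R ≃ₐ[k] AdicCompletion I' R' :=
  AlgEquiv.ofAlgHom (adicCompletionMap _ h) (adicCompletionMap _ h')
    (AlgHom.ext fun x ↦ adicCompletionMap_adicCompletionMap _ _ h' h (fun y ↦ by simp) x)
    (AlgHom.ext fun x ↦ adicCompletionMap_adicCompletionMap _ _ h h' (fun y ↦ by simp) x)

theorem nonempty_localization_algEquiv {k A B : Type*} [CommRing k] [CommRing A] [CommRing B]
    [Algebra k A] [Algebra k B] (x : PrimeSpectrum A) (y : PrimeSpectrum B) (e : A ≃ₐ[k] B)
    (h : ∀ a, e a ∈ y.asIdeal ↔ a ∈ x.asIdeal) :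
    Nonempty (Localization.AtPrime x.asIdeal ≃ₐ[k] Localization.AtPrime y.asIdeal) := by
  refine ⟨IsLocalization.algEquivOfAlgEquiv (M := x.asIdeal.primeCompl)
    (T := y.asIdeal.primeCompl) _ _ e ?_⟩
  ext b
  constructor
  · rintro ⟨a, ha, rfl⟩
    exact fun hb ↦ ha ((h a).1 hb)
  · intro hb
    refine ⟨e.symm b, fun ha ↦ hb ?_, by simp⟩
    simpa using (h (e.symm b)).2 ha

theorem isSingularPoint_of_algEquiv {k A B : Type*} [CommRing k] [CommRing A] [CommRing B]
    [Algebra k A] [Algebra k B] (x : PrimeSpectrum A) (y : PrimeSpectrum B) (e : A ≃ₐ[k] B)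
    (h : ∀ a, e a ∈ y.asIdeal ↔ a ∈ x.asIdeal) (hx : IsSingularPoint x) : IsSingularPoint y := by
  obtain ⟨f⟩ := nonempty_localization_algEquiv x y e h
  intro hy
  exact hx (IsRegularLocalRing.of_ringEquiv f.symm.toRingEquiv)

theorem formallyIsomorphic_of_algEquiv {k A B : Type*} [CommRing k] [CommRing A] [CommRing B]
    [Algebra k A] [Algebra k B] (x : PrimeSpectrum A) (y : PrimeSpectrum B) (e : A ≃ₐ[k] B)
    (h : ∀ a, e a ∈ y.asIdeal ↔ a ∈ x.asIdeal) : FormallyIsomorphic k x y := by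
  obtain ⟨f⟩ := nonempty_localization_algEquiv x y e h
  refine ⟨adicCompletionCongr f (fun a ha ↦ ?_) (fun a ha ↦ ?_)⟩
  · simpa [Ideal.mem_comap] using ha
  · simpa [Ideal.mem_comap] using ha

end FormalIsomorphism

/-! ### Parameters at a regular rational point; dimension in integral extensions. -/

section LocalParameters

/-- A `k`-rational point of `Spec A` with regular local ring has at most `n` local parameters when
`A` has dimension at most `n`. -/
theorem exists_span_sup_sq_of_regular {k A : Type*} [Field k] [CommRing A] [Algebra k A]
    (φ : A →ₐ[k] k) (x : PrimeSpectrum A) (hx : x.asIdeal = RingHom.ker φ)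
    (hreg : IsRegularLocalRing (Localization.AtPrime x.asIdeal)) (n : ℕ)
    (hdim : ringKrullDim A ≤ n) :
    ∃ t : Finset A, t.card ≤ n ∧ (∀ a ∈ t, φ a = 0) ∧ ∀ b, φ b = 0 →
      b ∈ Submodule.span k (t : Set A) ⊔ (RingHom.ker φ ^ 2).restrictScalars k := by
  classical
  set R := Localization.AtPrime x.asIdeal
  have hfg : (maximalIdeal R).FG := (isNoetherianRing_iff_ideal_fg R).1 inferInstance _
  have hle : (maximalIdeal R).spanFinrank ≤ n := by
    have h1 := hreg.spanFinrank_maximalIdeal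
    have h2 : ringKrullDim R ≤ n := by
      rw [IsLocalization.AtPrime.ringKrullDim_eq_height x.asIdeal R]
      exact (Ideal.height_le_ringKrullDim_of_ne_top x.2.ne_top).trans hdim
    rw [← h1] at h2
    exact_mod_cast h2
  have hmem : ∀ a : A, a ∈ x.asIdeal ↔ φ a = 0 := by intro a; rw [hx]; rfl
  have hfin : (maximalIdeal R).generators.Finite := Submodule.FG.finite_generators hfg
  have hcard : (maximalIdeal R).generators.ncard ≤ n := by
    rwa [Submodule.FG.generators_ncard hfg]
  have hspan : Ideal.span (maximalIdeal R).generators = maximalIdeal R :=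
    Submodule.span_generators _
  have hsurj : ∀ r : R, ∃ a : A, ∃ s ∈ x.asIdeal.primeCompl,
      r * algebraMap A R s = algebraMap A R a := by
    intro r
    obtain ⟨⟨a, s⟩, h⟩ := IsLocalization.surj x.asIdeal.primeCompl r
    exact ⟨a, s, s.2, h⟩
  choose num den hden hnum using hsurj
  -- Numerators of minimal generators of the maximal ideal: they differ from the generators by units
  -- of the localization.
  set t : Finset A := hfin.toFinset.image num
  have hu : ∀ s ∈ x.asIdeal.primeCompl, IsUnit (algebraMap A R s) := fun s hs ↦
    IsLocalization.map_units R (⟨s, hs⟩ : x.asIdeal.primeCompl)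
  have ht : ∀ a ∈ t, φ a = 0 := by
    intro a ha
    obtain ⟨r, hr, rfl⟩ := Finset.mem_image.1 ha
    have hr' : r ∈ maximalIdeal R :=
      Submodule.FG.generators_mem _ (hfin.mem_toFinset.1 hr)
    rw [← hmem, ← IsLocalization.AtPrime.to_map_mem_maximal_iff R x.asIdeal, ← hnum]
    exact Ideal.mul_mem_right _ _ hr'
  refine ⟨t, ?_, ht, fun b hb ↦ ?_⟩
  · refine Finset.card_image_le.trans ?_
    rwa [← Set.ncard_eq_toFinset_card _ hfin]
  have hmap : maximalIdeal R ≤ (Ideal.span (t : Set A)).map (algebraMap A R) := by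
    rw [← hspan, Ideal.span_le]
    intro r hr
    have h1 : algebraMap A R (num r) ∈ (Ideal.span (t : Set A)).map (algebraMap A R) :=
      Ideal.mem_map_of_mem _ (Ideal.subset_span (Finset.mem_coe.2
        (Finset.mem_image_of_mem _ (hfin.mem_toFinset.2 hr))))
    rw [← hnum] at h1
    exact (Ideal.mul_unit_mem_iff_mem _ (hu _ (hden r))).1 h1
  obtain ⟨s, hs, hsb⟩ := (IsLocalization.algebraMap_mem_map_algebraMap_iff x.asIdeal.primeCompl
    R (Ideal.span (t : Set A)) b).1 (hmap ((IsLocalization.AtPrime.to_map_mem_maximal_iff R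
      x.asIdeal b).2 ((hmem b).2 hb)))
  have hs0 : φ s ≠ 0 := fun h ↦ hs ((hmem s).2 h)
  -- Modulo the square of the maximal ideal, `A` acts on that ideal through `φ`. This turns ideal
  -- spans into `k`-spans and lets the denominator `s` be cancelled as the nonzero scalar `φ s`.
  have hmul : ∀ c z : A, φ z = 0 → c * z - φ c • z ∈ (RingHom.ker φ ^ 2) := by
    intro c z hz
    have : c * z - φ c • z = (c - algebraMap k A (φ c)) * z := by
      rw [Algebra.smul_def]; ring
    rw [this, pow_two]
    exact Ideal.mul_mem_mul (by simp [RingHom.mem_ker]) hz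
  set W := Submodule.span k (t : Set A) ⊔ (RingHom.ker φ ^ 2).restrictScalars k
  have hW : ∀ z ∈ Ideal.span (t : Set A), φ z = 0 ∧ z ∈ W := by
    intro z hz
    induction hz using Submodule.span_induction with
    | mem z hz => exact ⟨ht z hz, Submodule.mem_sup_left (Submodule.subset_span hz)⟩
    | zero => exact ⟨map_zero _, zero_mem _⟩
    | add y z _ _ hy hz => exact ⟨by simp [hy.1, hz.1], add_mem hy.2 hz.2⟩
    | smul c z _ hz =>
      refine ⟨by simp [hz.1], ?_⟩
      rw [smul_eq_mul, ← sub_add_cancel (c * z) (φ c • z)]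
      exact add_mem (Submodule.mem_sup_right (hmul c z hz.1)) (W.smul_mem _ hz.2)
  have h1 : φ s • b ∈ W := by
    rw [← sub_sub_cancel (s * b) (φ s • b)]
    exact sub_mem (hW _ hsb).2 (Submodule.mem_sup_right (hmul s b hb))
  exact (Submodule.smul_mem_iff _ hs0).1 h1

/-- The Krull dimension does not change in an integral extension. -/
theorem ringKrullDim_eq_of_isIntegral {A S : Type*} [CommRing A] [CommRing S] [Algebra A S]
    [Algebra.IsIntegral A S] (hinj : Function.Injective (algebraMap A S)) :
    ringKrullDim A = ringKrullDim S := by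
  have : FaithfulSMul A S := (faithfulSMul_iff_algebraMap_injective A S).2 hinj
  apply le_antisymm
  · refine iSup_le fun l ↦ ?_
    -- Lying over lifts the smallest prime of a chain; going up then lifts the whole chain.
    obtain ⟨P, -, hP, hP'⟩ := Ideal.exists_ideal_over_prime_of_isIntegral l.head.asIdeal
      (⊥ : Ideal S) (by simp [Ideal.comap_bot_of_injective _ hinj])
    have : P.LiesOver l.head.asIdeal := ⟨hP'.symm⟩
    obtain ⟨L, hL, -⟩ := Ideal.exists_ltSeries_of_hasGoingUp l P
    rw [← hL]
    exact Order.LTSeries.length_le_krullDim L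
  · exact Order.krullDim_le_of_strictMono (PrimeSpectrum.comap (algebraMap A S))
      fun p q hpq ↦ Ideal.IsIntegral.comap_lt_comap hpq

end LocalParameters

/-! ### Substitutions and translations on polynomial functions. -/

section Substitution

variable {k V : Type*} [Field k] [AddCommGroup V] [Module k V]

theorem substitution_ι (g : LinearMap.GeneralLinearGroup k V) (x : Module.Dual k V) :
    substitution g (SymmetricAlgebra.ι k _ x) = SymmetricAlgebra.ι k _ (x ∘ₗ (g : V →ₗ[k] V)) := by
  simp [substitution]
  rfl

theorem evalAt_ι (v : V) (x : Module.Dual k V) :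
    evalAt v (SymmetricAlgebra.ι k _ x) = x v := by
  simp [evalAt]

theorem evalAt_substitution (g : LinearMap.GeneralLinearGroup k V) (v : V) (f : PolyRing k V) :
    evalAt v (substitution g f) = evalAt ((g : V →ₗ[k] V) v) f := by
  have : (evalAt v).comp (substitution g) = evalAt ((g : V →ₗ[k] V) v) := by
    apply SymmetricAlgebra.algHom_ext
    ext x
    simp [substitution_ι, evalAt_ι]
  exact DFunLike.congr_fun this f

theorem substitution_mul (g h : LinearMap.GeneralLinearGroup k V) (f : PolyRing k V) :
    substitution (g * h) f = substitution h (substitution g f) := by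
  have : substitution (g * h) = (substitution h).comp (substitution g) := by
    apply SymmetricAlgebra.algHom_ext
    ext x
    simp [substitution_ι]
    rfl
  exact DFunLike.congr_fun this f

theorem substitution_one (f : PolyRing k V) : substitution 1 f = f := by
  have : substitution (1 : LinearMap.GeneralLinearGroup k V) = AlgHom.id k _ := by
    apply SymmetricAlgebra.algHom_ext
    ext x
    simp [substitution_ι]
    rfl
  exact DFunLike.congr_fun this f

theorem substitution_pow_succ (g : LinearMap.GeneralLinearGroup k V) (n : ℕ) (f : PolyRing k V) :
    substitution (g ^ (n + 1)) f = substitution g (substitution (g ^ n) f) := by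
  rw [pow_succ, substitution_mul]

theorem substitution_comm {g h : LinearMap.GeneralLinearGroup k V} (hgh : g * h = h * g)
    (f : PolyRing k V) :
    substitution g (substitution h f) = substitution h (substitution g f) := by
  rw [← substitution_mul, ← substitution_mul, hgh]

/-- The translation `f ↦ f(· + v)` on `S(V^*)`. -/
def translation (v : V) : PolyRing k V →ₐ[k] PolyRing k V :=
  SymmetricAlgebra.lift (SymmetricAlgebra.ι k (Module.Dual k V) +
    Algebra.linearMap k (PolyRing k V) ∘ₗ Module.Dual.eval k V v)

theorem translation_ι (v : V) (x : Module.Dual k V) :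
    translation v (SymmetricAlgebra.ι k _ x) =
      SymmetricAlgebra.ι k _ x + algebraMap k (PolyRing k V) (x v) := by
  simp [translation]

theorem evalAt_translation (v w : V) (f : PolyRing k V) :
    evalAt w (translation v f) = evalAt (w + v) f := by
  have : (evalAt (k := k) w).comp (translation v) = evalAt (w + v) := by
    apply SymmetricAlgebra.algHom_ext
    ext x
    simp [translation_ι, evalAt_ι]
  exact DFunLike.congr_fun this f

theorem translation_translation_neg (v : V) (f : PolyRing k V) :
    translation v (translation (-v) f) = f := by
  have : (translation (k := k) v).comp (translation (-v)) = AlgHom.id k (PolyRing k V) := by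
    apply SymmetricAlgebra.algHom_ext
    ext x
    simp [translation_ι]
  exact DFunLike.congr_fun this f

theorem substitution_translation (g : LinearMap.GeneralLinearGroup k V) (v : V)
    (hg : (g : V →ₗ[k] V) v = v) (f : PolyRing k V) :
    substitution g (translation v f) = translation v (substitution g f) := by
  have : (substitution g).comp (translation v) = (translation v).comp (substitution g) := by
    apply SymmetricAlgebra.algHom_ext
    ext x
    simp [translation_ι, substitution_ι, hg]
  exact DFunLike.congr_fun this f

end Substitution

/-! ### Homogeneous components. -/

section Grading

variable {k V : Type*} [Field k] [AddCommGroup V] [Module k V]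

open Polynomial in
/-- The polynomial `f(T · )`, whose coefficients are the homogeneous components of `f`. -/
def scaling : PolyRing k V →ₐ[k] (PolyRing k V)[X] :=
  SymmetricAlgebra.lift
    ((LinearMap.toSpanSingleton (PolyRing k V) _ X).restrictScalars k ∘ₗ
      SymmetricAlgebra.ι k (Module.Dual k V))

theorem scaling_ι (x : Module.Dual k V) :
    scaling (SymmetricAlgebra.ι k _ x) =
      Polynomial.C (SymmetricAlgebra.ι k _ x) * Polynomial.X := by
  simp [scaling, Polynomial.smul_eq_C_mul]

/-- The homogeneous component of degree `d` of a polynomial function. -/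
def component (d : ℕ) (f : PolyRing k V) : PolyRing k V := (scaling f).coeff d

theorem component_add (d : ℕ) (f g : PolyRing k V) :
    component d (f + g) = component d f + component d g := by
  simp [component]

theorem component_smul (d : ℕ) (c : k) (f : PolyRing k V) :
    component d (c • f) = c • component d f := by
  simp [component]

theorem component_sum {ι : Type*} (d : ℕ) (s : Finset ι) (f : ι → PolyRing k V) :
    component d (∑ i ∈ s, f i) = ∑ i ∈ s, component d (f i) := by
  simp [component]

theorem component_mul (d : ℕ) (f g : PolyRing k V) :
    component d (f * g) = ∑ ij ∈ Finset.HasAntidiagonal.antidiagonal d, component ij.1 f * component ij.2 g := by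
  simp [component, Polynomial.coeff_mul]

theorem sum_component (f : PolyRing k V) :
    ∑ d ∈ Finset.range ((scaling f).natDegree + 1), component d f = f := by
  have h : ((Polynomial.aeval (R := PolyRing k V) (1 : PolyRing k V)).restrictScalars k).comp
      scaling = AlgHom.id k (PolyRing k V) := by
    apply SymmetricAlgebra.algHom_ext
    ext x
    simp [scaling_ι]
  have h := DFunLike.congr_fun h f
  simp only [AlgHom.comp_apply, AlgHom.restrictScalars_apply, AlgHom.id_apply] at h
  conv_rhs => rw [← h]
  simp [Polynomial.aeval_eq_sum_range, component]

theorem component_zero (f : PolyRing k V) :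
    component 0 f = algebraMap k _ (evalAt 0 f) := by
  have h : ((Polynomial.aeval (R := PolyRing k V) (0 : PolyRing k V)).restrictScalars k).comp
      scaling = (Algebra.ofId k (PolyRing k V)).comp (evalAt 0) := by
    apply SymmetricAlgebra.algHom_ext
    ext x
    simp [scaling_ι, evalAt_ι]
  have h := DFunLike.congr_fun h f
  simp only [AlgHom.comp_apply, AlgHom.restrictScalars_apply, Polynomial.aeval_def,
    Polynomial.eval₂_at_zero, Algebra.algebraMap_self, RingHom.id_apply] at h
  exact h

theorem component_substitution (d : ℕ) (g : LinearMap.GeneralLinearGroup k V) (f : PolyRing k V) :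
    component d (substitution g f) = substitution g (component d f) := by
  have h : scaling.comp (substitution g) = (Polynomial.mapAlgHom (substitution g)).comp scaling := by
    apply SymmetricAlgebra.algHom_ext
    ext x
    simp [scaling_ι, substitution_ι]
  have h := DFunLike.congr_fun h f
  simp only [AlgHom.comp_apply] at h
  simp [component, h]

/-- This makes the maps `component d` mutually orthogonal projections. -/
theorem scaling_component (d : ℕ) (f : PolyRing k V) :
    scaling (component d f) = Polynomial.C (component d f) * Polynomial.X ^ d := by
  induction f using SymmetricAlgebra.induction generalizing d with
  | algebraMap r =>
    by_cases hd : d = 0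
    · subst hd
      simp [component, Polynomial.coeff_C, Polynomial.algebraMap_apply]
    · simp [component, Polynomial.algebraMap_apply, Polynomial.coeff_C, hd]
  | ι x =>
    by_cases hd : d = 1
    · subst hd
      simp [component, scaling_ι]
    · simp [component, scaling_ι, Polynomial.coeff_X, Ne.symm hd]
  | mul a b ha hb =>
    rw [component_mul, map_sum, map_sum, Finset.sum_mul]
    refine Finset.sum_congr rfl fun ij hij ↦ ?_
    rw [map_mul, ha, hb, map_mul, ← Finset.HasAntidiagonal.mem_antidiagonal.1 hij, pow_add]
    ring
  | add a b ha hb => rw [component_add, map_add, ha, hb, map_add, add_mul]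

theorem component_component (d e : ℕ) (f : PolyRing k V) :
    component e (component d f) = if e = d then component d f else 0 := by
  conv_lhs => rw [component, scaling_component]
  simp [Polynomial.coeff_X_pow]

end Grading

/-! ### Integrality, dimension and grading of the invariant ring. -/

section Invariants

variable {k V : Type*} [Field k] [AddCommGroup V] [Module k V]

theorem ringKrullDim_polyRing [FiniteDimensional k V] :
    ringKrullDim (PolyRing k V) = Module.finrank k V := by
  rw [ringKrullDim_eq_of_ringEquiv (SymmetricAlgebra.equivMvPolynomial
    (Module.finBasis k (Module.Dual k V))).toRingEquiv]
  simp

theorem invariantRing_isIntegral (G : Subgroup (LinearMap.GeneralLinearGroup k V)) [Finite G] :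
    Algebra.IsIntegral (invariantRing G) (PolyRing k V) := by
  -- Substitution reverses products, so it is the opposite group that acts on the left.
  let _ : MulSemiringAction (↥G)ᵐᵒᵖ (PolyRing k V) :=
    { smul g f := substitution g.unop.1 f
      one_smul f := substitution_one f
      mul_smul g h f := substitution_mul h.unop.1 g.unop.1 f
      smul_zero g := map_zero (substitution g.unop.1)
      smul_add g a b := map_add (substitution g.unop.1) a b
      smul_one g := map_one (substitution g.unop.1)
      smul_mul g a b := map_mul (substitution g.unop.1) a b }
  have : Algebra.IsInvariant (invariantRing G) (PolyRing k V) (↥G)ᵐᵒᵖ :=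
    ⟨fun b hb ↦ ⟨⟨b, fun g hg ↦ hb (MulOpposite.op ⟨g, hg⟩)⟩, rfl⟩⟩
  have : Finite (↥G)ᵐᵒᵖ := Finite.of_equiv _ MulOpposite.opEquiv
  exact Algebra.IsInvariant.isIntegral _ _ (↥G)ᵐᵒᵖ

theorem ringKrullDim_invariantRing [FiniteDimensional k V]
    (G : Subgroup (LinearMap.GeneralLinearGroup k V)) [Finite G] :
    ringKrullDim (invariantRing G) = Module.finrank k V := by
  have := invariantRing_isIntegral G
  rw [← ringKrullDim_polyRing (k := k) (V := V)]
  exact ringKrullDim_eq_of_isIntegral Subtype.val_injective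

theorem component_mem_invariantRing {G : Subgroup (LinearMap.GeneralLinearGroup k V)}
    {f : PolyRing k V} (hf : f ∈ invariantRing G) (d : ℕ) : component d f ∈ invariantRing G :=
  fun g hg ↦ by rw [← component_substitution, hf g hg]

theorem mem_quotientPoint (G : Subgroup (LinearMap.GeneralLinearGroup k V)) (v : V)
    (f : invariantRing G) : f ∈ (quotientPoint G v).asIdeal ↔ evalAt v f.1 = 0 := Iff.rfl

end Invariants

/-! ### Maximal ideals of invariant rings and separation of points by invariants. -/

section Vanishing

variable {k V : Type*} [Field k] [AddCommGroup V] [Module k V]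

/-- The elements of a subalgebra of `S(V^*)` that vanish at a vector. -/
def vanishing (B : Subalgebra k (PolyRing k V)) (v : V) : Submodule k (PolyRing k V) :=
  Subalgebra.toSubmodule B ⊓ LinearMap.ker (evalAt v).toLinearMap

theorem mem_vanishing {B : Subalgebra k (PolyRing k V)} {v : V} {f : PolyRing k V} :
    f ∈ vanishing B v ↔ f ∈ B ∧ evalAt v f = 0 := Iff.rfl

/-- Regularity expressed inside the ambient ring `S(V^*)`, where the maximal ideals of different
invariant rings can be compared. -/
theorem exists_parameters_of_not_isSingularPoint [FiniteDimensional k V]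
    (G : Subgroup (LinearMap.GeneralLinearGroup k V)) [Finite G] (v : V)
    (h : ¬ IsSingularPoint (quotientPoint G v)) :
    ∃ t : Finset (PolyRing k V), t.card ≤ Module.finrank k V ∧
      vanishing (invariantRing G) v ≤ Submodule.span k t ⊔
        vanishing (invariantRing G) v * vanishing (invariantRing G) v := by
  classical
  set φ := (evalAt v).comp (invariantRing G).val
  obtain ⟨t, ht, -, hspan⟩ := exists_span_sup_sq_of_regular φ (quotientPoint G v) rfl
    (not_not.1 h) (Module.finrank k V) (ringKrullDim_invariantRing G).le
  refine ⟨t.image Subtype.val, Finset.card_image_le.trans ht, ?_⟩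
  · rintro f ⟨hf, hfv⟩
    obtain ⟨y, hy, z, hz, hyz⟩ := Submodule.mem_sup.1 (hspan ⟨f, hf⟩ hfv)
    have hf' : f = y.1 + z.1 := (congrArg Subtype.val hyz).symm
    rw [hf']
    refine add_mem (Submodule.mem_sup_left ?_) (Submodule.mem_sup_right ?_)
    · have := Submodule.mem_map_of_mem (f := (invariantRing G).val.toLinearMap) hy
      rw [Submodule.map_span] at this
      rw [Finset.coe_image]
      exact this
    · have hz : z ∈ RingHom.ker φ * RingHom.ker φ := by rw [← pow_two]; exact hz
      refine Submodule.mul_induction_on hz (fun a ha b hb ↦ ?_) fun a b ha hb ↦ add_mem ha hb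
      exact Submodule.mul_mem_mul ⟨a.2, ha⟩ ⟨b.2, hb⟩

theorem exists_norm (N : Subgroup (LinearMap.GeneralLinearGroup k V)) [Fintype N]
    (F : PolyRing k V) : ∃ f ∈ invariantRing N,
      ∀ w, evalAt w f = ∏ h : N, evalAt ((h.1 : V →ₗ[k] V) w) F := by
  refine ⟨∏ h : N, substitution h.1 F, fun g hg ↦ ?_, fun w ↦ ?_⟩
  · rw [map_prod]
    simp only [← substitution_mul]
    exact Fintype.prod_equiv (Equiv.mulRight (⟨g, hg⟩ : N)) _ _ fun h ↦ rfl
  · rw [map_prod]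
    simp only [evalAt_substitution]

/-- Take the norm over `N` of `q(x)`, where `x` is a linear form with `x v = 1` and `q` has root set
`s`. As `N` fixes the line through `v` pointwise, the norm has value `q(c) ^ |N|` at `c • v`; then
normalize at `v`. -/
theorem exists_invariant_separating (N : Subgroup (LinearMap.GeneralLinearGroup k V)) [Finite N]
    (v : V) (hv : v ≠ 0) (hN : ∀ h ∈ N, (h : V →ₗ[k] V) v = v) (s : Finset k) (hs : 1 ∉ s) :
    ∃ f ∈ invariantRing N, evalAt v f = 1 ∧ ∀ c ∈ s, evalAt (c • v) f = 0 := by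
  have := Fintype.ofFinite N
  obtain ⟨x, hx⟩ := Module.Projective.exists_dual_eq_one k hv
  set q : Polynomial k := ∏ c ∈ s, (Polynomial.X - Polynomial.C c) with hq
  obtain ⟨f, hf, hfe⟩ := exists_norm N (Polynomial.aeval (SymmetricAlgebra.ι k _ x) q)
  have hval : ∀ c : k, evalAt (c • v) f = q.eval c ^ Fintype.card N := by
    intro c
    rw [hfe, ← Finset.card_univ, ← Finset.prod_const]
    refine Finset.prod_congr rfl fun h _ ↦ ?_
    rw [map_smul, hN h.1 h.2, ← Polynomial.aeval_algHom_apply, evalAt_ι, map_smul, hx]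
    simp
  have h1 : q.eval 1 ≠ 0 := by
    rw [hq, Polynomial.eval_prod]
    refine Finset.prod_ne_zero_iff.2 fun c hc ↦ ?_
    simpa using sub_ne_zero.2 fun h : 1 = c ↦ hs (h ▸ hc)
  have hfv : evalAt v f = q.eval 1 ^ Fintype.card N := by rw [← hval, one_smul]
  refine ⟨(q.eval 1 ^ Fintype.card N)⁻¹ • f, Subalgebra.smul_mem _ hf _, ?_, fun c hc ↦ ?_⟩
  · rw [map_smul, hfv, smul_eq_mul, inv_mul_cancel₀ (pow_ne_zero _ h1)]
  · have h0 : q.eval c = 0 := by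
      rw [hq, Polynomial.eval_prod]
      exact Finset.prod_eq_zero hc (by simp)
    rw [map_smul, hval, h0, zero_pow Fintype.card_ne_zero, smul_zero]

end Vanishing

/-! ### Descent of parameters along a cyclic quotient, and translation to the origin. -/

section CyclicQuotient

variable {k V : Type*} [Field k] [AddCommGroup V] [Module k V]

theorem substitution_pow_mem {B : Subalgebra k (PolyRing k V)}
    {g : LinearMap.GeneralLinearGroup k V} (hg : ∀ b ∈ B, substitution g b ∈ B) (i : ℕ)
    {b : PolyRing k V} (hb : b ∈ B) : substitution (g ^ i) b ∈ B := by
  induction i with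
  | zero => rwa [pow_zero, substitution_one]
  | succ i ih => rw [substitution_pow_succ]; exact hg _ ih

theorem pow_apply_eq_smul {g : LinearMap.GeneralLinearGroup k V} {v : V} {ζ : k}
    (hv : (g : V →ₗ[k] V) v = ζ • v) (i : ℕ) :
    ((g ^ i : LinearMap.GeneralLinearGroup k V) : V →ₗ[k] V) v = ζ ^ i • v := by
  induction i with
  | zero => simp
  | succ i ih => 
    rw [pow_succ, Units.val_mul, Module.End.mul_apply, hv, map_smul, ih, smul_smul, pow_succ']

/-- The extension `A ⊆ B` of the invariants of `g` is unramified at a point `v` whose translates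
under the powers of `g` are separated by `B`. -/
theorem vanishing_le_sup_sq {A B : Subalgebra k (PolyRing k V)}
    {g : LinearMap.GeneralLinearGroup k V} {m : ℕ} (hm : 0 < m)
    (hgB : ∀ b ∈ B, substitution g b ∈ B) (hgm : ∀ b ∈ B, substitution (g ^ m) b = b)
    (hA : ∀ b ∈ B, substitution g b = b → b ∈ A) {v : V} {ζ : k}
    (hv : (g : V →ₗ[k] V) v = ζ • v)
    {f : PolyRing k V} (hf : f ∈ B) (hfv : evalAt v f = 1)
    (hf0 : ∀ i, 0 < i → i < m → evalAt (ζ ^ i • v) f = 0) :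
    vanishing B v ≤ vanishing A v ⊔ vanishing B v * vanishing B v := by
  rintro b ⟨hb, hbv⟩
  -- The trace `a` of `c` is the invariant approximating `b`. The cutoff `f` is squared so that each
  -- conjugate of `c` by `g ^ i`, `0 < i < m`, contains two factors vanishing at `v`.
  set c := f * f * b with hc
  have hcB : c ∈ B := mul_mem (mul_mem hf hf) hb
  set a := ∑ i ∈ Finset.range m, substitution (g ^ i) c with ha
  have haB : a ∈ B := sum_mem fun i _ ↦ substitution_pow_mem hgB i hcB
  have hga : substitution g a = a := by
    rw [ha, map_sum]
    simp only [← substitution_pow_succ]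
    -- Applying `g` shifts the index; the two end terms agree because `g ^ m` acts trivially on `B`.
    have h1 := Finset.sum_range_succ (fun i ↦ substitution (g ^ i) c) m
    have h2 := Finset.sum_range_succ' (fun i ↦ substitution (g ^ i) c) m
    rw [h1, hgm c hcB, pow_zero, substitution_one] at h2
    exact (add_right_cancel h2).symm
  have hvan : ∀ i, 0 < i → i < m → substitution (g ^ i) f ∈ vanishing B v := fun i hi him ↦
    ⟨substitution_pow_mem hgB i hf, by
      change evalAt v _ = 0
      rw [evalAt_substitution, pow_apply_eq_smul hv, hf0 i hi him]⟩
  have hdecomp : b = a + ((1 - f * f) * b - ∑ i ∈ Finset.Ico 1 m, substitution (g ^ i) c) := by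
    have h0 : a = c + ∑ i ∈ Finset.Ico 1 m, substitution (g ^ i) c := by
      rw [ha, Finset.range_eq_Ico, Finset.sum_eq_sum_Ico_succ_bot hm, pow_zero, substitution_one]
    rw [h0, hc]
    ring
  have hR : (1 - f * f) * b - ∑ i ∈ Finset.Ico 1 m, substitution (g ^ i) c ∈
      vanishing B v * vanishing B v := by
    refine sub_mem (Submodule.mul_mem_mul (mem_vanishing.2
      ⟨sub_mem (one_mem B) (mul_mem hf hf), ?_⟩) ⟨hb, hbv⟩) (sum_mem fun i hi ↦ ?_)
    · simp [hfv]
    · have hi := Finset.mem_Ico.1 hi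
      rw [hc, mul_assoc, map_mul, map_mul]
      have h1 := hvan i hi.1 hi.2
      refine Submodule.mul_mem_mul h1
        (mem_vanishing.2 ⟨mul_mem (mem_vanishing.1 h1).1 (substitution_pow_mem hgB i hb), ?_⟩)
      have h2 : evalAt v (substitution (g ^ i) f) = 0 := h1.2
      simp [h2]
  have hav : evalAt v a = 0 := by
    have h1 : evalAt v ((1 - f * f) * b - ∑ i ∈ Finset.Ico 1 m, substitution (g ^ i) c) = 0 := by
      refine Submodule.mul_induction_on (C := fun r ↦ evalAt v r = 0) hR (fun p hp q _ ↦ ?_)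
        fun p q hp hq ↦ by rw [map_add, hp, hq, add_zero]
      rw [map_mul, (mem_vanishing.1 hp).2, zero_mul]
    have h2 := congrArg (evalAt v) hdecomp
    rw [map_add, h1, add_zero] at h2
    rw [← h2]
    exact hbv
  rw [hdecomp]
  exact add_mem (Submodule.mem_sup_left ⟨hA a haB hga, hav⟩) (Submodule.mem_sup_right hR)

theorem map_translation_vanishing (N : Subgroup (LinearMap.GeneralLinearGroup k V)) (v : V)
    (hN : ∀ h ∈ N, (h : V →ₗ[k] V) v = v) :
    (vanishing (invariantRing N) v).map (translation (k := k) v).toLinearMap =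
      vanishing (invariantRing N) 0 := by
  apply le_antisymm
  · rintro _ ⟨f, ⟨hf, hfv⟩, rfl⟩
    refine ⟨fun h hh ↦ ?_, ?_⟩
    · simp only [AlgHom.toLinearMap_apply]
      rw [substitution_translation h v (hN h hh), hf h hh]
    · simpa [evalAt_translation] using hfv
  · rintro f ⟨hf, hfv⟩
    refine ⟨translation (-v) f, ⟨fun h hh ↦ ?_, ?_⟩, translation_translation_neg v f⟩
    · rw [substitution_translation h (-v) (by rw [map_neg, hN h hh]), hf h hh]
    · simpa [evalAt_translation] using hfv

theorem exists_parameters_translate (N : Subgroup (LinearMap.GeneralLinearGroup k V)) (v : V)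
    (hN : ∀ h ∈ N, (h : V →ₗ[k] V) v = v) (t : Finset (PolyRing k V))
    (hspan : vanishing (invariantRing N) v ≤ Submodule.span k t ⊔
        vanishing (invariantRing N) v * vanishing (invariantRing N) v) :
    ∃ s : Finset (PolyRing k V), s.card ≤ t.card ∧
      vanishing (invariantRing N) 0 ≤ Submodule.span k s ⊔
        vanishing (invariantRing N) 0 * vanishing (invariantRing N) 0 := by
  classical
  refine ⟨t.image (translation v), Finset.card_image_le, ?_⟩
  have h := Submodule.map_mono (f := (translation (k := k) v).toLinearMap) hspan
  rw [Submodule.map_sup, Submodule.map_span, Submodule.map_mul,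
    map_translation_vanishing N v hN] at h
  rw [Finset.coe_image]
  exact h

end CyclicQuotient

/-! ### Choosing generators inside a spanning set. -/

section LinearAlgebra

/-- Generators of `W` modulo `W'` can be chosen in a spanning set. -/
theorem exists_fin_span_sup {k S : Type*} [Field k] [AddCommGroup S] [Module k S]
    (W W' : Submodule k S) (E : Set S) (hE : E ⊆ W) (hWE : W ≤ Submodule.span k E)
    (t : Finset S) (n : ℕ) (ht : t.card ≤ n) (hWt : W ≤ Submodule.span k t ⊔ W') :
    ∃ y : Fin n → S, (∀ i, y i ∈ E ∨ y i = 0) ∧ W ≤ Submodule.span k (Set.range y) ⊔ W' := by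
  classical
  obtain ⟨b, hbE, hbspan, hbli⟩ := exists_linearIndependent k (W'.mkQ '' E)
  have hker : Submodule.map W'.mkQ W' = ⊥ := by
    rw [← LinearMap.le_ker_iff_map, Submodule.ker_mkQ]
  have hle : Set.range ((↑) : b → S ⧸ W') ≤
      (Submodule.span k ((t.image W'.mkQ : Finset _) : Set (S ⧸ W')) : Set (S ⧸ W')) := by
    rintro _ ⟨x, rfl⟩
    obtain ⟨z, hz, hzx⟩ := hbE x.2
    have h1 := Submodule.mem_map_of_mem (f := W'.mkQ) (hWt (hE hz))
    rw [Submodule.map_sup, hker, sup_bot_eq, Submodule.map_span, hzx] at h1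
    rw [Finset.coe_image]
    exact h1
  have : Finite b := hbli.finite_of_le_span_finite _ _ hle
  let _ := Fintype.ofFinite b
  have hcard := linearIndependent_le_span_aux' _ hbli _ hle
  simp only [Finset.coe_sort_coe, Fintype.card_coe] at hcard
  obtain ⟨f⟩ : Nonempty (b ↪ Fin n) := Function.Embedding.nonempty_of_card_le
    (by rw [Fintype.card_fin]; exact hcard.trans (Finset.card_image_le.trans ht))
  have hlift : ∀ x : b, ∃ z ∈ E, W'.mkQ z = x := fun x ↦ hbE x.2
  choose z hzE hz using hlift
  -- The chosen generators may be fewer than `n`; the remaining slots are filled with zero.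
  refine ⟨Function.extend f z 0, fun i ↦ ?_, fun w hw ↦ ?_⟩
  · by_cases hi : ∃ x, f x = i
    · obtain ⟨x, rfl⟩ := hi
      exact Or.inl (by rw [f.injective.extend_apply]; exact hzE x)
    · exact Or.inr (by rw [Function.extend_apply' _ _ _ hi]; rfl)
  · have h1 : W'.mkQ w ∈ Submodule.span k b := by
      rw [hbspan, ← Submodule.map_span]
      exact Submodule.mem_map_of_mem (hWE hw)
    have h2 : b ⊆ W'.mkQ '' Set.range (Function.extend f z 0) := by
      intro x hx
      exact ⟨_, ⟨f ⟨x, hx⟩, rfl⟩, by rw [f.injective.extend_apply, hz]⟩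
    have h3 := Submodule.span_mono h2 h1
    rw [← Submodule.map_span] at h3
    obtain ⟨u, hu, huw⟩ := h3
    rw [← sub_add_cancel w u, add_comm]
    refine add_mem (Submodule.mem_sup_left hu) (Submodule.mem_sup_right ?_)
    rw [← Submodule.ker_mkQ W', LinearMap.mem_ker, map_sub, huw, sub_self]

end LinearAlgebra

/-! ### Homogeneous eigenvector generators and graded Nakayama. -/

section Eigenvectors

variable {k V : Type*} [Field k] [AddCommGroup V] [Module k V]

/-- `f` is homogeneous of degree `d`. -/
def IsHomogeneousOf (d : ℕ) (f : PolyRing k V) : Prop := ∃ h, f = component d h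

theorem IsHomogeneousOf.component_eq {d : ℕ} {f : PolyRing k V} (hf : IsHomogeneousOf d f) (e : ℕ) :
    component e f = if e = d then f else 0 := by
  obtain ⟨h, rfl⟩ := hf
  exact component_component d e h

theorem evalAt_zero_component {d : ℕ} (hd : d ≠ 0) (f : PolyRing k V) :
    evalAt 0 (component d f) = 0 := by
  have h := component_component d 0 f
  rw [component_zero, if_neg hd.symm] at h
  exact (SymmetricAlgebra.algebraMap_eq_zero_iff _ _).1 h

/-- The homogeneous eigenvectors of `g` in `B` vanishing at the origin. -/
def eigenElements (B : Subalgebra k (PolyRing k V)) (g : LinearMap.GeneralLinearGroup k V) (ζ : k) :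
    Set (PolyRing k V) :=
  {f | f ∈ vanishing B 0 ∧ (∃ d, IsHomogeneousOf d f) ∧ ∃ j : ℕ, substitution g f = ζ ^ j • f}

/-- Since `m` is invertible and `ζ` is a primitive `m`-th root of unity, the action of `g` on each
graded piece of `B` splits into eigenspaces by Fourier inversion. -/
theorem vanishing_zero_le_span_eigenElements {B : Subalgebra k (PolyRing k V)}
    (hB : ∀ f ∈ B, ∀ d, component d f ∈ B)
    {g : LinearMap.GeneralLinearGroup k V} {m : ℕ} (hm : (m : k) ≠ 0)
    (hgB : ∀ b ∈ B, substitution g b ∈ B) (hgm : ∀ b ∈ B, substitution (g ^ m) b = b)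
    {ζ : k} (hζ : IsPrimitiveRoot ζ m) :
    vanishing B 0 ≤ Submodule.span k (eigenElements B g ζ) := by
  have hm0 : m ≠ 0 := by rintro rfl; simp at hm
  have hζ0 : ζ ≠ 0 := hζ.ne_zero hm0
  rintro b ⟨hb, hbv⟩
  have hbv : evalAt 0 b = 0 := hbv
  rw [← sum_component b]
  refine sum_mem fun d _ ↦ ?_
  by_cases hd : d = 0
  · subst hd
    rw [component_zero, hbv, map_zero]
    exact zero_mem _
  set h := component d b with hh
  have hhB : h ∈ B := hB b hb d
  -- `P j` is `m` times the projection of `h` to the `ζ ^ j`-eigenspace.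
  set P : ℕ → PolyRing k V := fun j ↦
    ∑ i ∈ Finset.range m, (ζ⁻¹ ^ i) ^ j • substitution (g ^ i) h with hP
  have hsum : ∑ j ∈ Finset.range m, P j = (m : k) • h := by
    rw [hP, Finset.sum_comm, Finset.sum_eq_single_of_mem 0 (by simp [Nat.pos_of_ne_zero hm0])]
    · simp [substitution_one, Nat.cast_smul_eq_nsmul]
    · intro i hi hi0
      rw [← Finset.sum_smul]
      have h1 : ζ⁻¹ ^ i ≠ 1 := by
        rw [inv_pow, Ne, inv_eq_one]
        exact hζ.pow_ne_one_of_pos_of_lt hi0 (Finset.mem_range.1 hi)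
      have h2 := geom_sum_mul (ζ⁻¹ ^ i) m
      rw [← pow_mul, mul_comm i m, pow_mul, inv_pow ζ m, hζ.pow_eq_one, inv_one, one_pow, sub_self] at h2
      rw [(mul_eq_zero.1 h2).resolve_right (sub_ne_zero.2 h1), zero_smul]
  have hPmem : ∀ j, P j ∈ eigenElements B g ζ := by
    intro j
    have hPB : P j ∈ B := sum_mem fun i _ ↦ B.smul_mem (substitution_pow_mem hgB i hhB) _
    have hPd : P j = component d
        (∑ i ∈ Finset.range m, (ζ⁻¹ ^ i) ^ j • substitution (g ^ i) b) := by
      rw [component_sum]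
      simp only [component_smul, component_substitution]
      rfl
    refine ⟨⟨hPB, ?_⟩, ⟨d, _, hPd⟩, j, ?_⟩
    · rw [hPd]
      exact evalAt_zero_component hd _
    · have h1 := Finset.sum_range_succ (fun i ↦ (ζ⁻¹ ^ i) ^ j • substitution (g ^ i) h) m
      have h2 := Finset.sum_range_succ' (fun i ↦ (ζ⁻¹ ^ i) ^ j • substitution (g ^ i) h) m
      rw [h1, hgm h hhB, inv_pow, hζ.pow_eq_one, inv_one, one_pow, pow_zero, pow_zero,
        substitution_one, one_pow] at h2
      change substitution g (∑ i ∈ Finset.range m, (ζ⁻¹ ^ i) ^ j • substitution (g ^ i) h) =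
        ζ ^ j • ∑ i ∈ Finset.range m, (ζ⁻¹ ^ i) ^ j • substitution (g ^ i) h
      conv_rhs => rw [add_right_cancel h2]
      rw [map_sum, Finset.smul_sum]
      refine Finset.sum_congr rfl fun i _ ↦ ?_
      rw [map_smul, smul_smul, ← substitution_pow_succ]
      congr 1
      rw [← pow_mul, ← pow_mul, add_mul, pow_add, one_mul, mul_left_comm, ← mul_pow,
        mul_inv_cancel₀ hζ0, one_pow, mul_one]
  have h3 : (m : k) • h ∈ Submodule.span k (eigenElements B g ζ) := by
    rw [← hsum]
    exact sum_mem fun j _ ↦ Submodule.subset_span (hPmem j)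
  exact (Submodule.smul_mem_iff _ hm).1 h3

/-- Graded Nakayama lemma. -/
theorem le_adjoin_of_vanishing_le {B : Subalgebra k (PolyRing k V)}
    (hB : ∀ f ∈ B, ∀ d, component d f ∈ B) {n : ℕ} (y : Fin n → PolyRing k V)
    (hy : ∀ i, ∃ d, IsHomogeneousOf d (y i))
    (hspan : vanishing B 0 ≤
      Submodule.span k (Set.range y) ⊔ vanishing B 0 * vanishing B 0) :
    B ≤ Algebra.adjoin k (Set.range y) := by
  have key : ∀ d, ∀ b ∈ B, component d b ∈ Algebra.adjoin k (Set.range y) := by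
    intro d
    induction d using Nat.strong_induction_on with
    | _ d ih =>
    intro b hb
    by_cases hd : d = 0
    · subst hd
      rw [component_zero]
      exact Subalgebra.algebraMap_mem _ _
    obtain ⟨u, hu, w, hw, huw⟩ := Submodule.mem_sup.1
      (hspan (mem_vanishing.2 ⟨hB b hb d, evalAt_zero_component hd b⟩))
    have h1 : component d b = component d u + component d w := by
      rw [← component_add, huw, component_component, if_pos rfl]
    rw [h1]
    refine add_mem ?_ ?_
    · clear huw h1
      induction hu using Submodule.span_induction with
      | mem z hz =>
        obtain ⟨i, rfl⟩ := hz
        obtain ⟨e, he⟩ := hy i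
        rw [he.component_eq]
        split_ifs
        · exact Algebra.subset_adjoin ⟨i, rfl⟩
        · exact zero_mem _
      | zero => simp [component]
      | add p q _ _ hp hq => rw [component_add]; exact add_mem hp hq
      | smul c p _ hp => rw [component_smul]; exact Subalgebra.smul_mem _ hp c
    · refine Submodule.mul_induction_on
        (C := fun w ↦ component d w ∈ Algebra.adjoin k (Set.range y)) hw (fun p hp q hq ↦ ?_)
        fun p q hp hq ↦ by rw [component_add]; exact add_mem hp hq
      obtain ⟨hp, hp0⟩ := mem_vanishing.1 hp
      obtain ⟨hq, hq0⟩ := mem_vanishing.1 hq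
      rw [component_mul]
      refine sum_mem fun ij hij ↦ ?_
      have hij := Finset.HasAntidiagonal.mem_antidiagonal.1 hij
      -- Degree zero components vanish with the value at the origin, so in the surviving terms both
      -- factors have degree below `d`.
      by_cases hi : ij.1 = 0
      · rw [hi, component_zero, hp0, map_zero, zero_mul]
        exact zero_mem _
      by_cases hj : ij.2 = 0
      · rw [hj, component_zero, hq0, map_zero, mul_zero]
        exact zero_mem _
      exact mul_mem (ih _ (by omega) p hp) (ih _ (by omega) q hq)
  intro b hb
  rw [← sum_component b]
  exact sum_mem fun d _ ↦ key d b hb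

/-- A nontrivial relation among the `n` generators would force the dimension of `S^N` below `n`, but
that dimension is `n` by integrality. -/
theorem algebraicIndependent_of_adjoin_eq [FiniteDimensional k V]
    (N : Subgroup (LinearMap.GeneralLinearGroup k V)) [Finite N]
    (y : Fin (Module.finrank k V) → PolyRing k V)
    (hy : Algebra.adjoin k (Set.range y) = invariantRing N) : AlgebraicIndependent k y := by
  rw [algebraicIndependent_iff]
  intro p hp
  by_contra hp0
  have h := ringKrullDim_succ_le_of_surjective (MvPolynomial.aeval y).rangeRestrict.toRingHom
    (MvPolynomial.aeval y).rangeRestrict_surjective (mem_nonZeroDivisors_of_ne_zero hp0)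
    (Subtype.ext hp)
  have hr : (MvPolynomial.aeval y : MvPolynomial _ k →ₐ[k] _).range = invariantRing N := by
    rw [← hy, Algebra.adjoin_range_eq_range_aeval]
  rw [hr, ringKrullDim_invariantRing, MvPolynomial.ringKrullDim_of_isNoetherianRing] at h
  simp only [ringKrullDim_eq_zero_of_field, Nat.card_eq_fintype_card, Fintype.card_fin,
    zero_add] at h
  norm_cast at h
  omega

end Eigenvectors

/-! ### Realizing the action of `g` on the generators by a diagonal matrix. -/

section DiagonalGroup

variable {k V : Type*} [Field k] [AddCommGroup V] [Module k V]

theorem mem_invariantRing_zpowers (c : LinearMap.GeneralLinearGroup k V) (f : PolyRing k V) :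
    f ∈ invariantRing (Subgroup.zpowers c) ↔ substitution c f = f := by
  refine ⟨fun hf ↦ hf c (Subgroup.mem_zpowers c), fun hf ↦ ?_⟩
  let H : Subgroup (LinearMap.GeneralLinearGroup k V) :=
    { carrier := {h | substitution h f = f}
      mul_mem' := fun {a b} ha hb ↦ by
        change substitution _ f = f
        rw [substitution_mul, ha, hb]
      one_mem' := substitution_one f
      inv_mem' := fun {a} ha ↦ by
        change substitution _ f = f
        conv_lhs => rw [← show substitution a f = f from ha]
        rw [← substitution_mul, mul_inv_cancel, substitution_one] }
  exact fun g hg ↦ (Subgroup.zpowers_le (H := H)).2 hf hg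

/-- The diagonal transformation with given diagonal entries. -/
def diagonal {ι : Type*} (b : Module.Basis ι k V) (u : ι → kˣ) :
    LinearMap.GeneralLinearGroup k V :=
  LinearMap.GeneralLinearGroup.ofLinearEquiv (b.equiv (b.unitsSMul u) (Equiv.refl ι))

theorem diagonal_apply {ι : Type*} (b : Module.Basis ι k V) (u : ι → kˣ) (i : ι) :
    (diagonal b u : V →ₗ[k] V) (b i) = (u i : k) • b i := by
  simp [diagonal, Module.Basis.unitsSMul_apply, Units.smul_def]

theorem diagonal_pow_apply {ι : Type*} (b : Module.Basis ι k V) (u : ι → kˣ) (i : ι) (m : ℕ) :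
    ((diagonal b u ^ m : LinearMap.GeneralLinearGroup k V) : V →ₗ[k] V) (b i) =
      (u i : k) ^ m • b i :=
  pow_apply_eq_smul (diagonal_apply b u i) m

theorem coord_comp_diagonal {ι : Type*} (b : Module.Basis ι k V) (u : ι → kˣ) (i : ι) :
    b.coord i ∘ₗ (diagonal b u : V →ₗ[k] V) = (u i : k) • b.coord i := by
  refine b.ext fun j ↦ ?_
  by_cases h : i = j
  · subst h; simp [diagonal_apply]
  · simp [diagonal_apply, Ne.symm h]

theorem diagonal_pow_eq_one {ι : Type*} (b : Module.Basis ι k V) (u : ι → kˣ) (m : ℕ)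
    (hu : ∀ i, u i ^ m = 1) : diagonal b u ^ m = 1 := by
  refine Units.ext (b.ext fun i ↦ ?_)
  rw [diagonal_pow_apply, ← Units.val_pow_eq_pow_val, hu]
  simp

/-- Invariants of an automorphism diagonal in algebraically independent generators of the invariant
ring of `N` form the ring of invariants of a cyclic group of diagonal matrices. -/
theorem exists_cyclic_of_diagonal [FiniteDimensional k V]
    {G N : Subgroup (LinearMap.GeneralLinearGroup k V)}
    {g : LinearMap.GeneralLinearGroup k V}
    (hG : ∀ f, f ∈ invariantRing G ↔ f ∈ invariantRing N ∧ substitution g f = f)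
    (y : Fin (Module.finrank k V) → PolyRing k V) (hy : AlgebraicIndependent k y)
    (hyN : Algebra.adjoin k (Set.range y) = invariantRing N) (hy0 : ∀ i, evalAt 0 (y i) = 0)
    (u : Fin (Module.finrank k V) → kˣ) (hyu : ∀ i, substitution g (y i) = (u i : k) • y i)
    (m : ℕ) (hm : (m : k) ≠ 0) (hum : ∀ i, u i ^ m = 1) :
    ∃ C : Subgroup (LinearMap.GeneralLinearGroup k V), Finite C ∧ IsCyclic C ∧
      ¬ ringChar k ∣ Nat.card C ∧ ∃ e : invariantRing G ≃ₐ[k] invariantRing C,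
        ∀ a, evalAt 0 (e a).1 = evalAt 0 a.1 := by
  set b := Module.finBasis k V
  set c := diagonal b u with hc
  have hcm : c ^ m = 1 := diagonal_pow_eq_one b u m hum
  have hm0 : m ≠ 0 := by rintro rfl; simp at hm
  have hfin : IsOfFinOrder c := isOfFinOrder_iff_pow_eq_one.2 ⟨m, Nat.pos_of_ne_zero hm0, hcm⟩
  refine ⟨Subgroup.zpowers c, ?_, inferInstance, fun h ↦ ?_, ?_⟩
  · exact Set.finite_coe_iff.2 (finite_zpowers.2 hfin)
  · rw [Nat.card_zpowers] at h
    exact hm ((ringChar.spec k m).2 (h.trans (orderOf_dvd_of_pow_eq_one hcm)))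
  -- `ψ` maps the coordinate functions to the `y i`. It identifies `S(V^*)` with `S^N` and
  -- intertwines the diagonal `c` with `g`.
  set ψ : PolyRing k V →ₐ[k] PolyRing k V :=
    (MvPolynomial.aeval y).comp (SymmetricAlgebra.equivMvPolynomial b.dualBasis).toAlgHom with hψ
  have hψι : ∀ i, ψ (SymmetricAlgebra.ι k _ (b.coord i)) = y i := by
    intro i
    have := SymmetricAlgebra.equivMvPolynomial_ι_apply b.dualBasis i
    rw [Module.Basis.coe_dualBasis] at this
    simp [hψ, this]
  have hinj : Function.Injective ψ :=
    Function.Injective.comp (g := MvPolynomial.aeval y) hy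
      (SymmetricAlgebra.equivMvPolynomial b.dualBasis).injective
  have hmem : ∀ f, f ∈ invariantRing N ↔ ∃ f', ψ f' = f := by
    intro f
    rw [← hyN, Algebra.adjoin_range_eq_range_aeval, AlgHom.mem_range]
    constructor
    · rintro ⟨p, rfl⟩
      exact ⟨(SymmetricAlgebra.equivMvPolynomial b.dualBasis).symm p, by simp [hψ]⟩
    · rintro ⟨f', rfl⟩
      exact ⟨_, rfl⟩
  have hsub : ∀ f, substitution g (ψ f) = ψ (substitution c f) := by
    have : (substitution g).comp ψ = ψ.comp (substitution c) := by
      apply SymmetricAlgebra.algHom_ext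
      refine b.dualBasis.ext fun i ↦ ?_
      rw [Module.Basis.coe_dualBasis]
      change substitution g (ψ (SymmetricAlgebra.ι k _ (b.coord i))) =
        ψ (substitution c (SymmetricAlgebra.ι k _ (b.coord i)))
      rw [hψι, hyu, substitution_ι, hc, coord_comp_diagonal, map_smul, map_smul, hψι]
    exact fun f ↦ DFunLike.congr_fun this f
  have heval : ∀ f, evalAt 0 (ψ f) = evalAt 0 f := by
    have : (evalAt (k := k) (0 : V)).comp ψ = evalAt 0 := by
      apply SymmetricAlgebra.algHom_ext
      refine b.dualBasis.ext fun i ↦ ?_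
      rw [Module.Basis.coe_dualBasis]
      change evalAt 0 (ψ (SymmetricAlgebra.ι k _ (b.coord i))) =
        evalAt 0 (SymmetricAlgebra.ι k _ (b.coord i))
      rw [hψι, hy0, evalAt_ι, map_zero]
    exact fun f ↦ DFunLike.congr_fun this f
  have hψG : ∀ f : invariantRing (Subgroup.zpowers c), ψ f.1 ∈ invariantRing G := fun f ↦
    (hG _).2 ⟨(hmem _).2 ⟨_, rfl⟩, by rw [hsub, (mem_invariantRing_zpowers c f.1).1 f.2]⟩
  let e : invariantRing (Subgroup.zpowers c) ≃ₐ[k] invariantRing G :=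
    AlgEquiv.ofBijective ((ψ.comp (invariantRing (Subgroup.zpowers c)).val).codRestrict
      (invariantRing G) hψG) (by
      constructor
      · intro f f' h
        exact Subtype.ext (hinj (congrArg Subtype.val h))
      · rintro ⟨f, hf⟩
        obtain ⟨hfN, hfg⟩ := (hG f).1 hf
        obtain ⟨f', rfl⟩ := (hmem f).1 hfN
        rw [hsub] at hfg
        exact ⟨⟨f', (mem_invariantRing_zpowers c f').2 (hinj hfg)⟩, rfl⟩)
  refine ⟨e.symm, fun a ↦ ?_⟩
  have h1 : ψ (e.symm a).1 = a.1 := congrArg Subtype.val (e.apply_symm_apply a)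
  rw [← h1, heval]

end DiagonalGroup

/-! ### The common eigenvector, its character and its image in the quotient. -/

section Eigenvector

variable {k V : Type*} [Field k] [AddCommGroup V] [Module k V]

theorem exists_common_eigenvector [IsAlgClosed k] [FiniteDimensional k V] [Nontrivial V]
    (G : Subgroup (LinearMap.GeneralLinearGroup k V)) (hcomm : ∀ g ∈ G, ∀ h ∈ G, g * h = h * g) :
    ∃ v : V, v ≠ 0 ∧ ∀ g ∈ G, ∃ c : k, (g : V →ₗ[k] V) v = c • v := by
  obtain ⟨W, ⟨hW0, hWG⟩, hmin⟩ := WellFounded.has_min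
    (wellFounded_lt : WellFounded ((· < ·) : Submodule k V → Submodule k V → Prop))
    {W | W ≠ ⊥ ∧ ∀ g ∈ G, ∀ w ∈ W, (g : V →ₗ[k] V) w ∈ W}
    ⟨⊤, top_ne_bot, fun _ _ _ _ ↦ Submodule.mem_top⟩
  obtain ⟨v, hvW, hv0⟩ := W.ne_bot_iff.1 hW0
  refine ⟨v, hv0, fun g hg ↦ ?_⟩
  have : Nontrivial W := (Submodule.nontrivial_iff_ne_bot).2 hW0
  obtain ⟨μ, hμ⟩ := Module.End.exists_eigenvalue ((g : V →ₗ[k] V).restrict (hWG g hg))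
  obtain ⟨w, hw⟩ := hμ.exists_hasEigenvector
  have hgw : (g : V →ₗ[k] V) w.1 = μ • w.1 := congrArg Subtype.val hw.apply_eq_smul
  -- `E` is `G`-stable by commutativity, so minimality of `W` makes `g` a scalar on `W`.
  set E := W ⊓ Module.End.eigenspace (g : V →ₗ[k] V) μ with hE
  have hE0 : E ≠ ⊥ := E.ne_bot_iff.2
    ⟨w.1, ⟨w.2, Module.End.mem_eigenspace_iff.2 hgw⟩, fun h ↦ hw.2 (Subtype.ext h)⟩
  have hEG : ∀ h ∈ G, ∀ x ∈ E, (h : V →ₗ[k] V) x ∈ E := by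
    rintro h hh x ⟨hxW, hx⟩
    refine ⟨hWG h hh x hxW, Module.End.mem_eigenspace_iff.2 ?_⟩
    rw [← Module.End.mul_apply, ← Units.val_mul, hcomm g hg h hh, Units.val_mul,
      Module.End.mul_apply, Module.End.mem_eigenspace_iff.1 hx, map_smul]
  have hEW : W ≤ E := by
    by_contra hlt
    exact hmin E ⟨hE0, hEG⟩ (lt_of_le_not_ge inf_le_left hlt)
  exact ⟨μ, Module.End.mem_eigenspace_iff.1 (hEW hvW).2⟩

theorem evalAt_smul (t : k) (v : V) (f : PolyRing k V) :
    evalAt (t • v) f = ((scaling f).map (evalAt (k := k) v).toRingHom).eval t := by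
  have h : evalAt (t • v) =
      ((Polynomial.aeval t).comp (Polynomial.mapAlgHom (evalAt v))).comp scaling := by
    apply SymmetricAlgebra.algHom_ext
    ext x
    simp [scaling_ι, evalAt_ι]
    ring
  have h := DFunLike.congr_fun h f
  simpa [Polynomial.coe_aeval_eq_eval] using h

theorem exists_smul_quotientPoint_mem [Infinite k]
    (G : Subgroup (LinearMap.GeneralLinearGroup k V)) (v : V)
    (U : Set (PrimeSpectrum (invariantRing G))) (hU : IsOpen U) (h0 : quotientPoint G 0 ∈ U) :
    ∃ t : k, t ≠ 0 ∧ quotientPoint G (t • v) ∈ U := by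
  obtain ⟨_, ⟨f, rfl⟩, hf0, hfU⟩ :=
    PrimeSpectrum.isTopologicalBasis_basic_opens.exists_subset_of_mem_open h0 hU
  set p := (scaling f.1).map (evalAt (k := k) v).toRingHom with hp
  have hp0 : p.eval 0 ≠ 0 := by
    rw [hp, ← evalAt_smul, zero_smul]
    exact hf0
  -- The factor `X` lets one nonvanishing condition also guarantee `t ≠ 0`.
  have hpX : Polynomial.X * p ≠ 0 :=
    mul_ne_zero Polynomial.X_ne_zero fun h ↦ hp0 (by rw [h, Polynomial.eval_zero])
  obtain ⟨t, ht⟩ : ∃ t, (Polynomial.X * p).eval t ≠ 0 := by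
    by_contra! h
    exact hpX (Polynomial.funext fun t ↦ by rw [h, Polynomial.eval_zero])
  rw [Polynomial.eval_mul, Polynomial.eval_X] at ht
  refine ⟨t, left_ne_zero_of_mul ht, hfU ?_⟩
  have := right_ne_zero_of_mul ht
  rw [hp, ← evalAt_smul] at this
  exact this

theorem isClosed_quotientPoint (G : Subgroup (LinearMap.GeneralLinearGroup k V)) (v : V) :
    IsClosed {quotientPoint G v} := by
  rw [PrimeSpectrum.isClosed_singleton_iff_isMaximal]
  exact RingHom.ker_isMaximal_of_surjective _ fun c ↦ ⟨algebraMap k _ c, by simp⟩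

/-- The norm of a linear form that is `1` at `v` vanishes at the origin, whereas at `v` it is the
product of the nonzero scalars by which `G` acts on `v`. -/
theorem quotientPoint_ne_zero (G : Subgroup (LinearMap.GeneralLinearGroup k V)) [Finite G] {v : V}
    (hv : v ≠ 0) (hG : ∀ g ∈ G, ∃ c : k, (g : V →ₗ[k] V) v = c • v) :
    quotientPoint G v ≠ quotientPoint G 0 := by
  have := Fintype.ofFinite G
  obtain ⟨x, hx⟩ := Module.Projective.exists_dual_eq_one k hv
  obtain ⟨f, hf, hfe⟩ := exists_norm G (SymmetricAlgebra.ι k _ x)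
  intro h
  have h0 : (⟨f, hf⟩ : invariantRing G) ∈ (quotientPoint G 0).asIdeal := by
    rw [mem_quotientPoint, hfe]
    exact Finset.prod_eq_zero (Finset.mem_univ 1) (by simp [evalAt_ι])
  rw [← h, mem_quotientPoint, hfe] at h0
  obtain ⟨g, -, hg⟩ := Finset.prod_eq_zero_iff.1 h0
  obtain ⟨c, hc⟩ := hG g.1 g.2
  rw [evalAt_ι, hc, map_smul, hx, smul_eq_mul, mul_one] at hg
  rw [hg, zero_smul] at hc
  have hinj : Function.Injective (g.1 : V →ₗ[k] V) :=
    (LinearMap.GeneralLinearGroup.toLinearEquiv g.1).injective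
  exact hv (hinj (by rw [hc, map_zero]))

/-- The character by which a group acts on a common eigenvector. -/
theorem exists_character (G : Subgroup (LinearMap.GeneralLinearGroup k V)) {v : V}
    (hv : v ≠ 0) (hG : ∀ g ∈ G, ∃ c : k, (g : V →ₗ[k] V) v = c • v) :
    ∃ χ : G →* kˣ, ∀ g : G, (g.1 : V →ₗ[k] V) v = (χ g : k) • v := by
  choose c hc using fun g : G ↦ hG g.1 g.2
  have hinj := smul_left_injective k hv
  let χ₀ : G →* k :=
    { toFun := c
      map_one' := hinj (by
        change c 1 • v = (1 : k) • v
        rw [← hc 1]; simp)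
      map_mul' := fun g h ↦ hinj (by
        change c (g * h) • v = (c g * c h) • v
        rw [← hc, Subgroup.coe_mul, Units.val_mul, Module.End.mul_apply, hc h, map_smul, hc g,
          smul_smul, mul_comm]) }
  exact ⟨χ₀.toHomUnits, hc⟩

end Eigenvector

/-! ### From a regular eigenvector to a cyclic quotient. -/

section Abelian

variable {k V : Type*} [Field k] [AddCommGroup V] [Module k V]

theorem substitution_pow_eq_self {g : LinearMap.GeneralLinearGroup k V} {f : PolyRing k V}
    (hf : substitution g f = f) (i : ℕ) : substitution (g ^ i) f = f := by
  induction i with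
  | zero => rw [pow_zero, substitution_one]
  | succ i ih => rw [substitution_pow_succ, ih, hf]

/-- If the quotient by a finite abelian group is regular at the image of a nonzero common
eigenvector, then it is a nonmodular cyclic quotient. -/
theorem exists_cyclic_of_regular_eigenvector [FiniteDimensional k V]
    (G : Subgroup (LinearMap.GeneralLinearGroup k V)) [Finite G]
    (hcomm : ∀ g ∈ G, ∀ h ∈ G, g * h = h * g) {v : V} (hv : v ≠ 0)
    (hG : ∀ g ∈ G, ∃ c : k, (g : V →ₗ[k] V) v = c • v)
    (hreg : ¬ IsSingularPoint (quotientPoint G v)) :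
    ∃ C : Subgroup (LinearMap.GeneralLinearGroup k V), Finite C ∧ IsCyclic C ∧
      ¬ ringChar k ∣ Nat.card C ∧ ∃ e : invariantRing G ≃ₐ[k] invariantRing C,
        ∀ a, evalAt 0 (e a).1 = evalAt 0 a.1 := by
  classical
  obtain ⟨χ, hχ⟩ := exists_character G hv hG
  set N : Subgroup (LinearMap.GeneralLinearGroup k V) := χ.ker.map G.subtype with hNdef
  have hNG : N ≤ G := Subgroup.map_subtype_le _
  have : Finite N := Finite.of_injective _ (Subgroup.inclusion_injective hNG)
  have hN : ∀ h ∈ N, (h : V →ₗ[k] V) v = v := by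
    rintro _ ⟨h, hh, rfl⟩
    have h1 := hχ h
    rw [MonoidHom.mem_ker.1 hh, Units.val_one, one_smul] at h1
    exact h1
  have : Finite χ.range := Set.finite_range χ
  obtain ⟨⟨_, g, rfl⟩, hgen⟩ := IsCyclic.exists_monoid_generator (α := χ.range)
  set m := orderOf (χ g) with hm
  have hζ : IsPrimitiveRoot (χ g : k) m :=
    IsPrimitiveRoot.coe_units_iff.2 (IsPrimitiveRoot.orderOf (χ g))
  have hmpos : 0 < m := (MonoidHom.isOfFinOrder χ (isOfFinOrder_of_finite g)).orderOf_pos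
  have : NeZero m := ⟨hmpos.ne'⟩
  -- A field containing a primitive `m`-th root of unity has characteristic prime to `m`: this is
  -- the source of nonmodularity.
  have hmk : (m : k) ≠ 0 := hζ.neZero'.out
  have hgB : ∀ b ∈ invariantRing N, substitution g.1 b ∈ invariantRing N := fun b hb h hh ↦ by
    rw [substitution_comm (hcomm h (hNG hh) g.1 g.2), hb h hh]
  have hgm : ∀ b ∈ invariantRing N, substitution (g.1 ^ m) b = b := fun b hb ↦
    hb _ ⟨g ^ m, by rw [SetLike.mem_coe, MonoidHom.mem_ker, map_pow, hm, pow_orderOf_eq_one], rfl⟩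
  have hGN : ∀ f, f ∈ invariantRing G ↔ f ∈ invariantRing N ∧ substitution g.1 f = f := by
    refine fun f ↦ ⟨fun hf ↦ ⟨fun h hh ↦ hf h (hNG hh), hf g.1 g.2⟩, ?_⟩
    rintro ⟨hfN, hfg⟩ a ha
    obtain ⟨i, hi⟩ := hgen ⟨χ ⟨a, ha⟩, ⟨a, ha⟩, rfl⟩
    have hi : χ g ^ i = χ ⟨a, ha⟩ := congrArg Subtype.val hi
    have hn : (g.1 ^ i)⁻¹ * a ∈ N :=
      ⟨(g ^ i)⁻¹ * ⟨a, ha⟩, by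
        rw [SetLike.mem_coe, MonoidHom.mem_ker, map_mul, map_inv, map_pow, hi, inv_mul_cancel],
        rfl⟩
    have h1 := hfN _ hn
    rw [substitution_mul] at h1
    have h2 : substitution (g.1 ^ i)⁻¹ f = f := by
      conv_lhs => rw [← substitution_pow_eq_self hfg i]
      rw [← substitution_mul, mul_inv_cancel, substitution_one]
    rwa [h2] at h1
  obtain ⟨t, htn, ht⟩ := exists_parameters_of_not_isSingularPoint G v hreg
  obtain ⟨f, hf, hfv, hf0⟩ := exists_invariant_separating N v hv hN
    ((Finset.Ico 1 m).image fun i ↦ (χ g : k) ^ i) (by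
      rw [Finset.mem_image]
      rintro ⟨i, hi, h1⟩
      rw [Finset.mem_Ico] at hi
      exact hζ.pow_ne_one_of_pos_of_lt (Nat.one_le_iff_ne_zero.1 hi.1) hi.2 h1)
  have hsup := vanishing_le_sup_sq (A := invariantRing G) hmpos hgB hgm
    (fun b hb hb' ↦ (hGN b).2 ⟨hb, hb'⟩) (hχ g) hf hfv
    fun i hi him ↦ hf0 _ (Finset.mem_image_of_mem _ (Finset.mem_Ico.2 ⟨hi, him⟩))
  have hAB : vanishing (invariantRing G) v ≤ vanishing (invariantRing N) v := fun a ha ↦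
    ⟨((hGN a).1 ha.1).1, ha.2⟩
  -- Parameters of `S^G` at `v` also serve for `S^N`, by unramifiedness.
  have htB : vanishing (invariantRing N) v ≤ Submodule.span k t ⊔
      vanishing (invariantRing N) v * vanishing (invariantRing N) v :=
    hsup.trans (sup_le (ht.trans (sup_le_sup_left (mul_le_mul' hAB hAB) _)) le_sup_right)
  obtain ⟨s, hst, hs⟩ := exists_parameters_translate N v hN t htB
  have hcomp : ∀ f ∈ invariantRing N, ∀ d, component d f ∈ invariantRing N :=
    fun f hf d ↦ component_mem_invariantRing hf d
  obtain ⟨y, hyE, hy⟩ := exists_fin_span_sup (vanishing (invariantRing N) 0) _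
    (eigenElements (invariantRing N) g.1 (χ g : k)) (fun f hf ↦ hf.1)
    (vanishing_zero_le_span_eigenElements hcomp hmk hgB hgm hζ) s _ (hst.trans htn) hs
  have hyB : ∀ i, y i ∈ vanishing (invariantRing N) 0 := fun i ↦
    (hyE i).elim (fun h ↦ h.1) fun h ↦ h ▸ zero_mem _
  have hyd : ∀ i, ∃ d, IsHomogeneousOf d (y i) := fun i ↦
    (hyE i).elim (fun h ↦ h.2.1) fun h ↦ ⟨0, 0, by rw [h]; simp [component]⟩
  have hyg : ∀ i, ∃ j : ℕ, substitution g.1 (y i) = (χ g : k) ^ j • y i := fun i ↦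
    (hyE i).elim (fun h ↦ h.2.2) fun h ↦ ⟨0, by rw [h]; simp⟩
  choose j hj using hyg
  have hadj : Algebra.adjoin k (Set.range y) = invariantRing N := le_antisymm
    (Algebra.adjoin_le (by rintro _ ⟨i, rfl⟩; exact (hyB i).1))
    (le_adjoin_of_vanishing_le hcomp y hyd hy)
  exact exists_cyclic_of_diagonal hGN y (algebraicIndependent_of_adjoin_eq N y hadj) hadj
    (fun i ↦ (hyB i).2) (fun i ↦ χ g ^ j i) (fun i ↦ by rw [hj, Units.val_pow_eq_pow_val]) m hmk
    fun i ↦ by rw [← pow_mul, mul_comm, pow_mul, hm, pow_orderOf_eq_one, one_pow]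

end Abelian

end QuotientSingularity

end

/-! ### The main theorem. -/

theorem mainTheorem7 {k V : Type*} [Field k] [IsAlgClosed k] [AddCommGroup V] [Module k V]
    [FiniteDimensional k V] (G : Subgroup (LinearMap.GeneralLinearGroup k V)) [Finite G]
    (hcomm : ∀ g ∈ G, ∀ h ∈ G, g * h = h * g)
    (hiso : QuotientSingularity.IsIsolatedSingularity (QuotientSingularity.quotientPoint G 0)) :
    ∃ C : Subgroup (LinearMap.GeneralLinearGroup k V),
      QuotientSingularity.IsNonmodularCyclicQuotientSingularity C ∧
        QuotientSingularity.FormallyIsomorphic k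
          (QuotientSingularity.quotientPoint G 0) (QuotientSingularity.quotientPoint C 0) := by
  rcases subsingleton_or_nontrivial V with hV | hV
  -- For `V = 0` there is no eigenvector; the group is trivial and serves as `C` itself.
  · have : Subsingleton (LinearMap.GeneralLinearGroup k V) :=
      ⟨fun a b ↦ Units.ext (Subsingleton.elim _ _)⟩
    refine ⟨G, ⟨inferInstance, inferInstance, ?_, hiso.1⟩, ⟨AlgEquiv.refl⟩⟩
    rw [Nat.card_of_subsingleton (1 : G), ← ringChar.spec]
    simp
  obtain ⟨hsing, U, hU, hU0, hUreg⟩ := hiso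
  obtain ⟨v₀, hv₀, hG₀⟩ := QuotientSingularity.exists_common_eigenvector G hcomm
  have : Infinite k := IsAlgClosed.instInfinite
  obtain ⟨t, ht, htU⟩ := QuotientSingularity.exists_smul_quotientPoint_mem G v₀ U hU hU0
  have hv : t • v₀ ≠ 0 := smul_ne_zero ht hv₀
  have hG : ∀ g ∈ G, ∃ c : k, (g : V →ₗ[k] V) (t • v₀) = c • t • v₀ := fun g hg ↦ by
    obtain ⟨c, hc⟩ := hG₀ g hg
    exact ⟨c, by rw [map_smul, hc, smul_comm]⟩
  obtain ⟨C, hfin, hcyc, hchar, e, he⟩ :=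
    QuotientSingularity.exists_cyclic_of_regular_eigenvector G hcomm hv hG
      (hUreg _ htU (QuotientSingularity.isClosed_quotientPoint G _)
        (QuotientSingularity.quotientPoint_ne_zero G hv hG))
  have h0 : ∀ a, e a ∈ (QuotientSingularity.quotientPoint C 0).asIdeal ↔
      a ∈ (QuotientSingularity.quotientPoint G 0).asIdeal := fun a ↦ by
    rw [QuotientSingularity.mem_quotientPoint, QuotientSingularity.mem_quotientPoint, he]
  exact ⟨C, ⟨hfin, hcyc, hchar, QuotientSingularity.isSingularPoint_of_algEquiv _ _ e h0 hsing⟩,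
    QuotientSingularity.formallyIsomorphic_of_algEquiv _ _ e h0⟩
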